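/- Let $t\ge 0$ and $n\in\{2,3\}$, write $J_n=\{2,\dots,n\}$, and write points of $\mathbb R^{t+n}$ as $(\mathbf y,\mathbf x)$ with $\mathbf y\in\mathbb R^t$, $\mathbf x\in\mathbb R^n$; let $\pi(\mathbf y,\mathbf x)=\mathbf y$. Let $f_1,\dots,f_n,g_1,\dots,g_r\in\mathbb Q[\mathbf y,\mathbf x]$, let $\sigma_1,\dots,\sigma_r\in\{<,>,\neq\}$, and $$E=\{(\mathbf y,\mathbf x)\in\mathbb R^{t+n}: f_1=\dots=f_n=0,\ g_k(\mathbf y,\mathbf x)\,\sigma_k\,0\ (1\le k\le r)\}.$$ Let $U\subset\mathbb R^t$ be an open set with $\pi(E)\subset U$. Let $A_1,\dots,A_n,B_1,C_1,C_0,\mathfrak n$ and $u_k,v_k$ $(k\in J_n)$ be polynomials in $\mathbb Q[\mathbf y]$, put $B_k=u_kx_1+v_k$ for $k\in J_n$, and $$\tilde f_1=A_1x_1^2+B_1x_1+C_1,\qquad \tilde f_k=A_kx_k+B_k\ (k\in J_n),\qquad \tilde f_{n+1}=x_nx_{n-1}-C_0 .$$ Assume the following. (1) Triangular form. For $(\mathbf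 y,\mathbf x)\in U\times\mathbb R^n$: $f_1=\dots=f_n=0$ if and only if $\tilde f_1=\dots=\tilde f_{n+1}=0$. The polynomials $A_1,\dots,A_n$ are nonzero; $\gcd(A_1,B_1,C_1)=1$; for every $k\in J_n$, $\gcd(A_k,u_k,v_k)=1$ and $\gcd(\mathfrak n,A_k)=1$. If $n=2$: $u_2=A_1\mathfrak n$, $v_2=B_1\mathfrak n$, $A_2C_0=C_1\mathfrak n$. If $n=3$: $u_2u_3=A_1\mathfrak n$, $v_3u_2+u_3v_2=B_1\mathfrak n$, $v_3v_2-A_2A_3C_0=C_1\mathfrak n$. (2) Non-degeneracy. Put $p_2=B_1$ if $n=2$, and $p_2=-p_3=(u_3v_2-u_2v_3)/\mathfrak n$ if $n=3$. At every point of $U$: $C_0\ne0$ and $\mathfrak n\neq 0$; $A_1$ and $B_1$ do not both vanish; and, for each $k\in J_n$, $A_k$ does not vanish simultaneously with $A_1$, nor with $p_k$, nor with $u_k$. (3) Normal form. Let $(Q_k)_{k\in\mathcal J}$ be the irreducible factors of $g_1\cdots g_r$, and $\mathcal V_{Q_k}=\{\tilde f_1=\dots=\tilde f_{n+1}=Q_k=0\}\subset\mathbb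 R^{t+n}$. For each $k\in\mathcal J$ there are $q_k,\alpha_k,\beta_k\in\mathbb Q[\mathbf y]$ such that $\alpha_k$ has no zero in $U$ and $$\mathcal V_{Q_k}\cap(U\times\mathbb R^n)=\{q_k=0,\ \alpha_kx_1+\beta_k=0,\ \tilde f_2=\dots=\tilde f_{n+1}=0\}\cap(U\times\mathbb R^n).$$ (4) With $\Delta=B_1^2-4A_1C_1$, no path-connected component of $E$ is contained in $\{\Delta=0\}$. For $\epsilon\in\{-1,1\}$ put $$F_o=\{\mathbf y\in U:\Delta\ge0\},\qquad \mathcal W_\infty=\{A_1\cdots A_n=0\},$$ $$F_\epsilon=F_o\setminus\Big(\{A_1=0,\ \epsilon B_1\le0\}\cup\bigcup_{k\in J_n}\{A_k=0,\ \epsilon p_k\ge0\}\Big).$$ Let $\xi^{(\epsilon)}:F_\epsilon\to\mathbb R^n$ be the extension by continuity of the map given on $F_o\setminus\mathcal W_\infty$ by $$x_1^{(\epsilon)}=\frac{-B_1+\epsilon\sqrt\Delta}{2A_1},\qquad x_k^{(\epsilon)}=-\frac{u_kx_1^{(\epsilon)}+v_k}{A_k}\quad(k\in J_n).$$ Put $$E^{(\epsilon)}=\{(\mathbf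 y,\mathbf x)\in E:\ \mathbf y\in F_\epsilon,\ \epsilon(2A_1x_1+B_1)\ge0\},$$ $$\mathcal W_{Q_k}^{(\epsilon)}=\pi\big(\mathcal V_{Q_k}\cap\{(\mathbf y,\xi^{(\epsilon)}(\mathbf y)):\mathbf y\in F_\epsilon\}\big),\qquad G_\epsilon=F_\epsilon\setminus\bigcup_{k\in\mathcal J}\mathcal W_{Q_k}^{(\epsilon)} .$$ Let $w_Q\in\mathbb Q[\mathbf y]$ be a nonzero polynomial that vanishes on $\pi(\mathcal V_{Q_k})\cap U$ for every $k\in\mathcal J$. Let $L$ be a set of sample points that is contained in $\{\mathbf y\in U:\ \Delta>0,\ A_1\cdots A_n\,w_Q\neq0\}$ and meets each path-connected component of this set. Put $L_o^{(\epsilon)}=\{\eta\in L:(\eta,\xi^{(\epsilon)}(\eta))\in E\}$, and let $G_{o,\epsilon}$ be the union of those path-connected components of $G_\epsilon$ that contain a point of $L_o^{(\epsilon)}$. Then, for each $\epsilon\in\{-1,1\}$, $E^{(\epsilon)}$ is homeomorphic to $G_{o,\epsilon}$. -/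

import Mathlib

open Set Topology

noncomputable section

/-- Value at a real point `y` of a polynomial in the parameters. -/
def evalParam {t : ℕ} (P : MvPolynomial (Fin t) ℚ) (y : Fin t → ℝ) : ℝ :=
  MvPolynomial.aeval y P

/-- Value at a real point `z = (y, x)` of a polynomial in the parameters and the unknowns. -/
def evalPoint {t n : ℕ} (P : MvPolynomial (Fin t ⊕ Fin n) ℚ)
    (z : (Fin t → ℝ) × (Fin n → ℝ)) : ℝ :=
  MvPolynomial.aeval (Sum.elim z.1 z.2) P

/-- The possible comparison symbols `σ` of a constraint `g σ 0`. -/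
inductive SignRel where
  | lt
  | le
  | gt
  | ge
  | ne

/-- `σ.Holds a` is the assertion `a σ 0`. -/
def SignRel.Holds : SignRel → ℝ → Prop
  | .lt, a => a < 0
  | .le, a => a ≤ 0
  | .gt, a => 0 < a
  | .ge, a => 0 ≤ a
  | .ne, a => a ≠ 0

/-- `σ` is a strict inequality or `≠`. -/
def SignRel.IsStrict (σ : SignRel) : Prop :=
  σ = .lt ∨ σ = .gt ∨ σ = .ne

/-- The real zero set of a polynomial sequence. -/
def realZeros {t n s : ℕ} (f : Fin s → MvPolynomial (Fin t ⊕ Fin n) ℚ) :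
    Set ((Fin t → ℝ) × (Fin n → ℝ)) :=
  {z | ∀ i, evalPoint (f i) z = 0}

/-- The semi-algebraic set `f = 0`, `g₁ σ₁ 0, …, g_r σ_r 0`. -/
def solutionSet {t n s r : ℕ} (f : Fin s → MvPolynomial (Fin t ⊕ Fin n) ℚ)
    (g : Fin r → MvPolynomial (Fin t ⊕ Fin n) ℚ) (σ : Fin r → SignRel) :
    Set ((Fin t → ℝ) × (Fin n → ℝ)) :=
  realZeros f ∩ {z | ∀ k, (σ k).Holds (evalPoint (g k) z)}

/-- The irreducible factors (up to units) of the product `g₁ ⋯ g_r`, equivalently of its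
square-free part. -/
def irreducibleFactors {t n r : ℕ} (g : Fin r → MvPolynomial (Fin t ⊕ Fin n) ℚ) :
    Set (MvPolynomial (Fin t ⊕ Fin n) ℚ) :=
  {Q | Irreducible Q ∧ Q ∣ ∏ k, g k}

/-- The set of path-connected components of a subset of a topological space. -/
def pathComponentsOf {X : Type*} [TopologicalSpace X] (S : Set X) : Set (Set X) :=
  {C | ∃ x ∈ S, C = {y | JoinedIn S x y}}

/-- `L` is the output of an exhaustive sampling of `S`: a set of points of `S` that meets
every path-connected component of `S`. -/
def IsExhaustiveSample {X : Type*} [TopologicalSpace X] (L S : Set X) : Prop :=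
  L ⊆ S ∧ ∀ C ∈ pathComponentsOf S, (C ∩ L).Nonempty

/-- The coefficients, polynomials in the `t` parameters, of a quadratic triangular system in
`n = m + 2` unknowns. The indices are shifted: `A 0, …, A (n - 1)` are `A₁, …, A_n` and
`u 0, …, u (n - 2)` are `u₂, …, u_n`, and in the same way for `v`. The polynomial `N` is the
one that relates the equations to each other. -/
structure TriangularSystem (t m : ℕ) where
  A : Fin (m + 2) → MvPolynomial (Fin t) ℚ
  B₁ : MvPolynomial (Fin t) ℚ
  C₁ : MvPolynomial (Fin t) ℚ
  C₀ : MvPolynomial (Fin t) ℚ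
  u : Fin (m + 1) → MvPolynomial (Fin t) ℚ
  v : Fin (m + 1) → MvPolynomial (Fin t) ℚ
  N : MvPolynomial (Fin t) ℚ

namespace TriangularSystem

variable {t m : ℕ}

/-- The pivot equation `A₁ x₁² + B₁ x₁ + C₁ = 0`. -/
def Pivot (S : TriangularSystem t m) (z : (Fin t → ℝ) × (Fin (m + 2) → ℝ)) : Prop :=
  evalParam (S.A 0) z.1 * z.2 0 ^ 2 + evalParam S.B₁ z.1 * z.2 0 + evalParam S.C₁ z.1 = 0

/-- The other equations: `A_k x_k + u_k x₁ + v_k = 0` for `2 ≤ k ≤ n`, and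
`x_n x_{n-1} - C₀ = 0`. -/
def Tail (S : TriangularSystem t m) (z : (Fin t → ℝ) × (Fin (m + 2) → ℝ)) : Prop :=
  (∀ k : Fin (m + 1), evalParam (S.A k.succ) z.1 * z.2 k.succ
      + (evalParam (S.u k) z.1 * z.2 0 + evalParam (S.v k) z.1) = 0) ∧
    z.2 (Fin.last (m + 1)) * z.2 (Fin.last m).castSucc - evalParam S.C₀ z.1 = 0

/-- The real zero set of the whole triangular system. -/
def zeros (S : TriangularSystem t m) : Set ((Fin t → ℝ) × (Fin (m + 2) → ℝ)) :=
  {z | S.Pivot z ∧ S.Tail z}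

/-- The discriminant `Δ = B₁² - 4 A₁ C₁` of the pivot equation. -/
def disc (S : TriangularSystem t m) (y : Fin t → ℝ) : ℝ :=
  evalParam S.B₁ y ^ 2 - 4 * evalParam (S.A 0) y * evalParam S.C₁ y

/-- The functions `p₂, …, p_n` (with shifted index): `p₂ = B₁` if `n = 2`, and
`p₂ = -p₃ = (u₃ v₂ - u₂ v₃) / N` if `n = 3`. They are used only where `N ≠ 0`. -/
def p (S : TriangularSystem t m) (k : Fin (m + 1)) (y : Fin t → ℝ) : ℝ :=
  if m = 0 then evalParam S.B₁ y
  else (if k = 0 then 1 else -1) *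
    ((evalParam (S.u (Fin.last m)) y * evalParam (S.v 0) y
      - evalParam (S.u 0) y * evalParam (S.v (Fin.last m)) y) / evalParam S.N y)

/-- Non-vanishing of the leading coefficients, coprimality of the coefficients, and the
relation `A₂ C₀ + B₂ x₁ = N (A₁ x₁² + B₁ x₁ + C₁)` if `n = 2`, respectively
`B₂ B₃ - A₂ A₃ C₀ = N (A₁ x₁² + B₁ x₁ + C₁)` if `n = 3`, written coefficientwise in `x₁`,
where `B_k = u_k x₁ + v_k`. -/
structure IsCompatible (S : TriangularSystem t m) : Prop where
  leading_ne_zero : ∀ k, S.A k ≠ 0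
  coprime_pivot : ∀ d, d ∣ S.A 0 → d ∣ S.B₁ → d ∣ S.C₁ → IsUnit d
  coprime_tail : ∀ (k : Fin (m + 1)) (d : MvPolynomial (Fin t) ℚ),
    d ∣ S.A k.succ → d ∣ S.u k → d ∣ S.v k → IsUnit d
  coprime_N : ∀ k : Fin (m + 1), IsRelPrime S.N (S.A k.succ)
  relation_two : m = 0 →
    S.u 0 = S.A 0 * S.N ∧ S.v 0 = S.B₁ * S.N ∧ S.A 1 * S.C₀ = S.C₁ * S.N
  relation_three : m = 1 →
    S.u 0 * S.u (Fin.last m) = S.A 0 * S.N ∧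
    S.v (Fin.last m) * S.u 0 + S.u (Fin.last m) * S.v 0 = S.B₁ * S.N ∧
    S.v (Fin.last m) * S.v 0 - S.A 1 * S.A (Fin.last (m + 1)) * S.C₀ = S.C₁ * S.N

/-- The non-degeneracy conditions, required on the cylinder `U × ℝⁿ`. All of them concern the
parameters only. -/
structure IsNondegenerate (S : TriangularSystem t m) (U : Set (Fin t → ℝ)) : Prop where
  C₀_ne_zero : ∀ y ∈ U, evalParam S.C₀ y ≠ 0
  A₁_A : ∀ k : Fin (m + 1), ∀ y ∈ U,
    ¬ (evalParam (S.A 0) y = 0 ∧ evalParam (S.A k.succ) y = 0)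
  N_ne_zero : ∀ y ∈ U, evalParam S.N y ≠ 0
  A₁_B₁ : ∀ y ∈ U, ¬ (evalParam (S.A 0) y = 0 ∧ evalParam S.B₁ y = 0)
  A_p : ∀ k : Fin (m + 1), ∀ y ∈ U, ¬ (evalParam (S.A k.succ) y = 0 ∧ S.p k y = 0)
  A_u : ∀ k : Fin (m + 1), ∀ y ∈ U,
    ¬ (evalParam (S.A k.succ) y = 0 ∧ evalParam (S.u k) y = 0)

/-- The real locus of the system together with `Q = 0`. -/
def locus (S : TriangularSystem t m) (Q : MvPolynomial (Fin t ⊕ Fin (m + 2)) ℚ) :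
    Set ((Fin t → ℝ) × (Fin (m + 2) → ℝ)) :=
  {z | z ∈ S.zeros ∧ evalPoint Q z = 0}

/-- On the cylinder `U × ℝⁿ`, the locus of `Q` is cut out by an equation `q(y) = 0`, an equation
`α(y) x₁ + β(y) = 0` with `α` nowhere zero on `U`, and all equations of the system except the
pivot. -/
def HasNormalForm (S : TriangularSystem t m) (U : Set (Fin t → ℝ))
    (Q : MvPolynomial (Fin t ⊕ Fin (m + 2)) ℚ) : Prop :=
  ∃ q α β : MvPolynomial (Fin t) ℚ,
    (∀ z : (Fin t → ℝ) × (Fin (m + 2) → ℝ), z.1 ∈ U →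
      (z ∈ S.locus Q ↔ evalParam q z.1 = 0 ∧
        evalParam α z.1 * z.2 0 + evalParam β z.1 = 0 ∧ S.Tail z)) ∧
    ∀ y ∈ U, evalParam α y ≠ 0

/-- `F_o`, the set where `Δ ≥ 0` inside `U`. -/
def Fo (S : TriangularSystem t m) (U : Set (Fin t → ℝ)) : Set (Fin t → ℝ) :=
  {y | y ∈ U ∧ 0 ≤ S.disc y}

/-- `W_∞`, the set where some leading coefficient vanishes. -/
def Winf (S : TriangularSystem t m) : Set (Fin t → ℝ) :=
  {y | ∃ k, evalParam (S.A k) y = 0}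

/-- `F_ε`: the set `F_o` without the points where `A₁ = 0` and `ε B₁ ≤ 0`, and without those
where `A_k = 0` and `ε p_k ≥ 0` for some `2 ≤ k ≤ n`. -/
def F (S : TriangularSystem t m) (U : Set (Fin t → ℝ)) (ε : ℝ) : Set (Fin t → ℝ) :=
  S.Fo U \ ({y | evalParam (S.A 0) y = 0 ∧ ε * evalParam S.B₁ y ≤ 0} ∪
    ⋃ k : Fin (m + 1), {y | evalParam (S.A k.succ) y = 0 ∧ 0 ≤ ε * S.p k y})

/-- The first coordinate `(-B₁ + ε √Δ) / (2 A₁)` of the branch, where `A₁ ≠ 0`. -/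
def branchRoot (S : TriangularSystem t m) (ε : ℝ) (y : Fin t → ℝ) : ℝ :=
  (-evalParam S.B₁ y + ε * √(S.disc y)) / (2 * evalParam (S.A 0) y)

/-- The branch `ξ^(ε)` by its formula, meaningful on `F_o \ W_∞`. -/
def branchFormula (S : TriangularSystem t m) (ε : ℝ) (y : Fin t → ℝ) : Fin (m + 2) → ℝ :=
  Fin.cons (S.branchRoot ε y) fun k : Fin (m + 1) =>
    -(evalParam (S.u k) y * S.branchRoot ε y + evalParam (S.v k) y) / evalParam (S.A k.succ) y

/-- The branch `ξ^(ε)`, extended by continuity from `F_o \ W_∞` (to `F_ε`). -/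
def branch (S : TriangularSystem t m) (U : Set (Fin t → ℝ)) (ε : ℝ) :
    (Fin t → ℝ) → (Fin (m + 2) → ℝ) :=
  extendFrom (S.Fo U \ S.Winf) (S.branchFormula ε)

/-- The graph of the branch over `F_ε`. -/
def branchGraph (S : TriangularSystem t m) (U : Set (Fin t → ℝ)) (ε : ℝ) :
    Set ((Fin t → ℝ) × (Fin (m + 2) → ℝ)) :=
  {z | z.1 ∈ S.F U ε ∧ z.2 = S.branch U ε z.1}

/-- `E^(ε)`, the part of `E` over `F_ε` where `ε (2 A₁ x₁ + B₁) ≥ 0`. -/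
def branchPiece (S : TriangularSystem t m) (U : Set (Fin t → ℝ))
    (E : Set ((Fin t → ℝ) × (Fin (m + 2) → ℝ))) (ε : ℝ) :
    Set ((Fin t → ℝ) × (Fin (m + 2) → ℝ)) :=
  {z | z ∈ E ∧ z.1 ∈ S.F U ε ∧
    0 ≤ ε * (2 * evalParam (S.A 0) z.1 * z.2 0 + evalParam S.B₁ z.1)}

/-- `W_Q^(ε)`, the projection of the part of the locus of `Q` on the graph of the branch. -/
def projectedLocus (S : TriangularSystem t m) (U : Set (Fin t → ℝ)) (ε : ℝ)
    (Q : MvPolynomial (Fin t ⊕ Fin (m + 2)) ℚ) : Set (Fin t → ℝ) :=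
  Prod.fst '' (S.locus Q ∩ S.branchGraph U ε)

/-- `G_ε`: the set `F_ε` without the projected loci of the polynomials of `J`. -/
def G (S : TriangularSystem t m) (U : Set (Fin t → ℝ)) (ε : ℝ)
    (J : Set (MvPolynomial (Fin t ⊕ Fin (m + 2)) ℚ)) : Set (Fin t → ℝ) :=
  S.F U ε \ ⋃ Q ∈ J, S.projectedLocus U ε Q

/-- The open set that is sampled: `Δ > 0`, all `A_k ≠ 0` and `w ≠ 0`, inside `U`. -/
def sampledSet (S : TriangularSystem t m) (U : Set (Fin t → ℝ))
    (w : MvPolynomial (Fin t) ℚ) : Set (Fin t → ℝ) :=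
  {y | y ∈ U ∧ 0 < S.disc y ∧ y ∉ S.Winf ∧ evalParam w y ≠ 0}

/-- `L_o^(ε)`, the sample points whose lift by the branch lies in `E`. -/
def goodSamples (S : TriangularSystem t m) (U : Set (Fin t → ℝ)) (ε : ℝ)
    (E : Set ((Fin t → ℝ) × (Fin (m + 2) → ℝ))) (L : Set (Fin t → ℝ)) : Set (Fin t → ℝ) :=
  {η | η ∈ L ∧ (η, S.branch U ε η) ∈ E}

/-- `G_{o,ε}`, the union of the components of `G_ε` that contain a point of `L_o^(ε)`. -/
def Go (S : TriangularSystem t m) (U : Set (Fin t → ℝ)) (ε : ℝ)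
    (J : Set (MvPolynomial (Fin t ⊕ Fin (m + 2)) ℚ))
    (E : Set ((Fin t → ℝ) × (Fin (m + 2) → ℝ))) (L : Set (Fin t → ℝ)) : Set (Fin t → ℝ) :=
  ⋃₀ {C | C ∈ pathComponentsOf (S.G U ε J) ∧ (C ∩ S.goodSamples U ε E L).Nonempty}

end TriangularSystem

end

open Filter

noncomputable section

/-! The piece E^(ε) is the graph of ξ^(ε) over the set H of those y in F_ε with (y, ξ^(ε)(y)) in E
(`liftable`). Projection and lifting by ξ^(ε) are then inverse to each other, and both are
continuous. This needs ξ^(ε) to be continuous on F_ε (`continuousOn_branch`), to take values in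
zeros of the system (`branch_mem_zeros`), and to be the only zero with the prescribed sign
(`eq_branch`). Where A₁ or A_k vanishes, the formulas for x₁ and x_k are replaced by equivalent
fractions whose denominators stay nonzero on F_ε.

It remains to see that H is the union of the selected components of G_ε. Strict signs put H inside
G_ε, and no g_k can change sign along a path of G_ε, so H is a union of path components
(`liftable_of_joinedIn`). Each of these components must contain a sample point. By the assumption on
Δ, a point of H is joined inside H to one with Δ > 0 (`exists_joinedIn_disc_pos`). From there a
small move avoids the zeros of A₁⋯A_n w, and the sampled set, which lies in G_ε, leads to a point of
L (`exists_joinedIn_sample`). -/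

/-! ### Polynomial functions and strict sign conditions -/

theorem continuous_evalParam {t : ℕ} (P : MvPolynomial (Fin t) ℚ) :
    Continuous (evalParam P) := by
  unfold evalParam
  simp only [MvPolynomial.aeval_def, MvPolynomial.eval₂_eq]
  fun_prop

theorem continuous_evalPoint {t n : ℕ} (P : MvPolynomial (Fin t ⊕ Fin n) ℚ) :
    Continuous (evalPoint P) := by
  have h : Continuous fun z : (Fin t → ℝ) × (Fin n → ℝ) ↦ (Sum.elim z.1 z.2 : Fin t ⊕ Fin n → ℝ) :=
    continuous_pi fun i ↦ by cases i <;> simp <;> fun_prop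
  unfold evalPoint
  simp only [MvPolynomial.aeval_def, MvPolynomial.eval₂_eq]
  fun_prop

/-- A nonzero polynomial does not vanish identically on a nonempty open set. -/
theorem exists_evalParam_ne_zero {t : ℕ} {P : MvPolynomial (Fin t) ℚ} (hP : P ≠ 0)
    {V : Set (Fin t → ℝ)} {y : Fin t → ℝ} (hV : V ∈ 𝓝 y) : ∃ z ∈ V, evalParam P z ≠ 0 := by
  obtain ⟨δ, hδ, hball⟩ := Metric.mem_nhds_iff.1 hV
  by_contra! h
  apply hP
  apply MvPolynomial.map_injective (algebraMap ℚ ℝ) (algebraMap ℚ ℝ).injective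
  rw [map_zero]
  -- A sup-metric ball is a product of intervals, and a polynomial that vanishes on a product of
  -- infinite sets is zero.
  apply MvPolynomial.funext_set (fun i ↦ Metric.ball (y i) δ)
  · intro i
    rw [Real.ball_eq_Ioo]
    exact Ioo_infinite (by linarith)
  · intro x hx
    have hx' : x ∈ Metric.ball y δ := by
      rw [ball_pi y hδ]; exact hx
    have := h x (hball hx')
    simpa [evalParam, MvPolynomial.eval_map, MvPolynomial.aeval_def] using this

theorem SignRel.IsStrict.isOpen_holds {σ : SignRel} (h : σ.IsStrict) :
    IsOpen {a | σ.Holds a} := by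
  rcases h with rfl | rfl | rfl
  · exact isOpen_Iio
  · exact isOpen_Ioi
  · exact isOpen_ne

theorem SignRel.IsStrict.ne_zero {σ : SignRel} (h : σ.IsStrict) {a : ℝ} (ha : σ.Holds a) :
    a ≠ 0 := by
  rcases h with rfl | rfl | rfl
  · exact ne_of_lt ha
  · exact ne_of_gt ha
  · exact ha

/-- A strict sign condition is preserved along a path on which the function does not vanish. -/
theorem SignRel.IsStrict.holds_of_continuous {σ : SignRel} (h : σ.IsStrict)
    {X : Type*} [TopologicalSpace X] [PreconnectedSpace X] {φ : X → ℝ} (hφ : Continuous φ)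
    (h0 : ∀ x, φ x ≠ 0) {a b : X} (ha : σ.Holds (φ a)) : σ.Holds (φ b) := by
  rcases h with rfl | rfl | rfl
  · by_contra hb
    obtain ⟨x, hx⟩ := mem_range_of_exists_le_of_exists_ge hφ ⟨a, le_of_lt ha⟩ ⟨b, not_lt.1 hb⟩
    exact h0 x hx
  · by_contra hb
    obtain ⟨x, hx⟩ := mem_range_of_exists_le_of_exists_ge hφ ⟨b, not_lt.1 hb⟩ ⟨a, le_of_lt ha⟩
    exact h0 x hx
  · exact h0 b

/-- A polynomial that vanishes at a point has an irreducible factor that does. -/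
theorem exists_irreducible_dvd_evalPoint_eq_zero {t n : ℕ} {P : MvPolynomial (Fin t ⊕ Fin n) ℚ}
    (hP : P ≠ 0) {z : (Fin t → ℝ) × (Fin n → ℝ)} (hz : evalPoint P z = 0) :
    ∃ Q, Irreducible Q ∧ Q ∣ P ∧ evalPoint Q z = 0 := by
  induction P using UniqueFactorizationMonoid.induction_on_prime with
  | h₁ => exact absurd rfl hP
  | h₂ P hu =>
    have := hu.map (MvPolynomial.aeval (R := ℚ) (Sum.elim z.1 z.2 : Fin t ⊕ Fin n → ℝ))
    exact absurd hz this.ne_zero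
  | h₃ P p hP0 hp ih =>
    have hmul : evalPoint p z * evalPoint P z = 0 := by simpa [evalPoint] using hz
    rcases mul_eq_zero.1 hmul with h | h
    · exact ⟨p, hp.irreducible, dvd_mul_right _ _, h⟩
    · obtain ⟨Q, hQ, hd, hQz⟩ := ih hP0 h
      exact ⟨Q, hQ, hd.mul_left _, hQz⟩

/-! ### Partner relations for x_k -/

namespace TriangularSystem

variable {t m : ℕ}

/-- Data that express the relations of a compatible system between the unknown `x_k` and its
partner (`x_1` if `n = 2`, the remaining unknown if `n = 3`). -/
structure IsPartner (S : TriangularSystem t m) (k : Fin (m + 1))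
    (a b c : MvPolynomial (Fin t) ℚ) : Prop where
  quadratic : S.u k * b = S.A 0 * S.N
  linear : c * S.u k + b * S.v k = S.B₁ * S.N
  const : c * S.v k - S.A k.succ * a * S.C₀ = S.C₁ * S.N
  p_mul : ∀ y, evalParam S.N y ≠ 0 → S.p k y * evalParam S.N y =
    evalParam b y * evalParam (S.v k) y - evalParam (S.u k) y * evalParam c y
  tail : ∀ z, S.Tail z → evalParam a z.1 * evalParam S.C₀ z.1 +
    (evalParam b z.1 * z.2 0 + evalParam c z.1) * z.2 k.succ = 0

/-- For n = 2, the product equation x₂x₁ = C₀ is already the required relation, whence (a, b, c) =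
(-1, 1, 0). For n = 3, with j the other index, multiplying A_j x_j + u_j x₁ + v_j = 0 by x_k and
replacing x_j x_k by C₀ gives (a, b, c) = (A_j, u_j, v_j). -/
theorem IsCompatible.exists_isPartner {S : TriangularSystem t m} (hS : S.IsCompatible)
    (hm : m = 0 ∨ m = 1) (k : Fin (m + 1)) : ∃ a b c, S.IsPartner k a b c := by
  rcases hm with rfl | rfl
  · obtain ⟨h1, h2, h3⟩ := hS.relation_two rfl
    obtain rfl : k = 0 := Fin.fin_one_eq_zero k
    refine ⟨-1, 1, 0, ?_, ?_, ?_, ?_, ?_⟩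
    · linear_combination h1
    · linear_combination h2
    · change 0 * S.v 0 - S.A 1 * (-1) * S.C₀ = _
      linear_combination h3
    · intro y hy
      have := congrArg (fun P ↦ evalParam P y) h2
      simp [evalParam, p] at this ⊢
      linarith
    · rintro ⟨y, x⟩ ⟨-, h⟩
      simp [evalParam] at h ⊢
      change x 1 * x 0 - _ = 0 at h
      linear_combination h
  · obtain ⟨h1, h2, h3⟩ := hS.relation_three rfl
    change S.u 0 * S.u 1 = _ at h1
    change S.v 1 * S.u 0 + S.u 1 * S.v 0 = _ at h2
    change S.v 1 * S.v 0 - S.A 1 * S.A 2 * S.C₀ = _ at h3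
    have key : ∀ z, S.Tail z →
        (evalParam (S.A 1) z.1 * z.2 1 + (evalParam (S.u 0) z.1 * z.2 0 + evalParam (S.v 0) z.1) = 0)
        ∧ (evalParam (S.A 2) z.1 * z.2 2 + (evalParam (S.u 1) z.1 * z.2 0 + evalParam (S.v 1) z.1) = 0)
        ∧ z.2 2 * z.2 1 - evalParam S.C₀ z.1 = 0 :=
      fun z hz ↦ ⟨hz.1 0, hz.1 1, hz.2⟩
    have hl : Fin.last 1 = 1 := rfl
    fin_cases k
    · refine ⟨S.A 2, S.u 1, S.v 1, h1, h2, h3, ?_, ?_⟩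
      · intro y hy
        simp [p, hl]
        field_simp
      · intro z hz
        obtain ⟨-, e2, e3⟩ := key z hz
        change _ + _ * z.2 1 = 0
        linear_combination z.2 1 * e2 - evalParam (S.A 2) z.1 * e3
    · refine ⟨S.A 1, S.u 0, S.v 0, ?_, ?_, ?_, ?_, ?_⟩
      · change S.u 1 * S.u 0 = _
        linear_combination h1
      · change S.v 0 * S.u 1 + S.u 0 * S.v 1 = _
        linear_combination h2
      · change S.v 0 * S.v 1 - S.A 2 * S.A 1 * S.C₀ = _
        linear_combination h3
      · intro y hy
        simp [p, hl]
        field_simp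
        ring
      · intro z hz
        obtain ⟨e1, -, e3⟩ := key z hz
        change _ + _ * z.2 2 = 0
        linear_combination z.2 2 * e1 - evalParam (S.A 1) z.1 * e3

section Partner

variable {S : TriangularSystem t m} {k : Fin (m + 1)} {a b c : MvPolynomial (Fin t) ℚ}

theorem IsPartner.eval (h : S.IsPartner k a b c) (y : Fin t → ℝ) :
    evalParam (S.u k) y * evalParam b y = evalParam (S.A 0) y * evalParam S.N y ∧
    evalParam c y * evalParam (S.u k) y + evalParam b y * evalParam (S.v k) y
      = evalParam S.B₁ y * evalParam S.N y ∧
    evalParam c y * evalParam (S.v k) y - evalParam (S.A k.succ) y * evalParam a y * evalParam S.C₀ y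
      = evalParam S.C₁ y * evalParam S.N y := by
  refine ⟨?_, ?_, ?_⟩
  · simpa [evalParam] using congrArg (fun P ↦ evalParam P y) h.quadratic
  · simpa [evalParam] using congrArg (fun P ↦ evalParam P y) h.linear
  · simpa [evalParam] using congrArg (fun P ↦ evalParam P y) h.const

/-- Where `A_k = 0`, the discriminant is the square of `p_k`. -/
theorem IsPartner.disc_eq (h : S.IsPartner k a b c) {y : Fin t → ℝ}
    (hNy : evalParam S.N y ≠ 0) (hA : evalParam (S.A k.succ) y = 0) :
    S.disc y = S.p k y ^ 2 := by
  obtain ⟨h1, h2, h3⟩ := h.eval y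
  have h4 := h.p_mul y hNy
  rw [hA] at h3
  -- With A_k = 0, N²Δ = (cu + bv)² - 4(ub)(cv) = (bv - uc)².
  have : S.disc y * evalParam S.N y ^ 2 = S.p k y ^ 2 * evalParam S.N y ^ 2 := by
    rw [← mul_pow, h4, disc]
    linear_combination -(evalParam S.B₁ y * evalParam S.N y +
      (evalParam c y * evalParam (S.u k) y + evalParam b y * evalParam (S.v k) y)) * h2
      + 4 * evalParam (S.A 0) y * evalParam S.N y * h3
      + 4 * (evalParam c y * evalParam (S.v k) y) * h1
  exact mul_right_cancel₀ (pow_ne_zero 2 hNy) this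

/-- Where `A_k = 0` and `ε p_k < 0`, the linear form of the partner does not vanish at the root
of the pivot equation that is selected by `ε`. -/
theorem IsPartner.linear_ne_zero (h : S.IsPartner k a b c) {y : Fin t → ℝ} {ε x : ℝ}
    (hε : ε = 1 ∨ ε = -1)
    (hNy : evalParam S.N y ≠ 0) (hA : evalParam (S.A k.succ) y = 0)
    (hp : ε * S.p k y < 0)
    (hx : ε * (2 * evalParam (S.A 0) y * x + evalParam S.B₁ y) = √(S.disc y)) :
    evalParam b y * x + evalParam c y ≠ 0 := by
  obtain ⟨h1, h2, h3⟩ := h.eval y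
  have h4 := h.p_mul y hNy
  have hp0 : S.p k y ≠ 0 := by rintro h0; simp [h0] at hp
  have hs : √(S.disc y) = -(ε * S.p k y) := by
    rw [h.disc_eq hNy hA, Real.sqrt_eq_iff_mul_self_eq (sq_nonneg _) (by linarith)]
    rcases hε with rfl | rfl <;> ring
  have hx' : 2 * evalParam (S.A 0) y * x + evalParam S.B₁ y = - S.p k y := by
    rw [hs] at hx
    rcases hε with rfl | rfl <;> linarith
  -- Since N(2A₁x + B₁) - N p_k = 2u_k(bx + c), a zero of bx + c would make 2A₁x + B₁ equal to both
  -- p_k and -p_k.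
  intro h0
  apply mul_ne_zero hp0 hNy
  linear_combination (1 / 2) * evalParam S.N y * hx' - evalParam (S.u k) y * h0 + (1 / 2) * h2
    + x * h1 + (1 / 2) * h4

end Partner

/-! ### The set F_ε and the branch off W_∞ -/

section Branch

variable {S : TriangularSystem t m} {U : Set (Fin t → ℝ)} {ε : ℝ}

theorem continuous_disc (S : TriangularSystem t m) : Continuous S.disc := by
  have h0 := continuous_evalParam (S.A 0)
  have h1 := continuous_evalParam S.B₁
  have h2 := continuous_evalParam S.C₁
  unfold disc
  fun_prop

theorem continuousAt_p (S : TriangularSystem t m) (k : Fin (m + 1)) {y : Fin t → ℝ}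
    (hy : evalParam S.N y ≠ 0) : ContinuousAt (S.p k) y := by
  unfold p
  split_ifs
  all_goals
    have h (P : MvPolynomial (Fin t) ℚ) : ContinuousAt (evalParam P) y :=
      (continuous_evalParam P).continuousAt
    first
    | exact h _
    | exact continuousAt_const.mul
        ((((h _).mul (h _)).sub ((h _).mul (h _))).div (h _) hy)

theorem mem_F_iff {y : Fin t → ℝ} : y ∈ S.F U ε ↔ (y ∈ U ∧ 0 ≤ S.disc y) ∧
    (evalParam (S.A 0) y ≠ 0 ∨ 0 < ε * evalParam S.B₁ y) ∧
    ∀ k : Fin (m + 1), evalParam (S.A k.succ) y ≠ 0 ∨ ε * S.p k y < 0 := by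
  simp only [F, Fo, Set.mem_sdiff, mem_ofPred_eq, mem_union, mem_iUnion, not_or, not_exists, not_and,
    not_le, ← imp_iff_not_or, ne_eq]

theorem Fo_diff_Winf_subset_F : S.Fo U \ S.Winf ⊆ S.F U ε := by
  rintro y ⟨hy, hW⟩
  simp only [Winf, mem_ofPred_eq, not_exists] at hW
  exact mem_F_iff.2 ⟨hy, Or.inl (hW 0), fun k ↦ Or.inl (hW _)⟩

/-- `F_ε` is relatively open in `F_o`. -/
theorem eventually_mem_F (hU : IsOpen U) (hN : S.IsNondegenerate U) {y : Fin t → ℝ}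
    (hy : y ∈ S.F U ε) : ∀ᶠ z in 𝓝 y, 0 ≤ S.disc z → z ∈ S.F U ε := by
  obtain ⟨⟨hyU, hd⟩, h0, hk⟩ := mem_F_iff.1 hy
  have h (P : MvPolynomial (Fin t) ℚ) : ContinuousAt (evalParam P) y :=
    (continuous_evalParam P).continuousAt
  have e1 : ∀ᶠ z in 𝓝 y, evalParam (S.A 0) z ≠ 0 ∨ 0 < ε * evalParam S.B₁ z := by
    rcases h0 with h0 | h0
    · exact ((h _).eventually_ne h0).mono fun _ ↦ Or.inl
    · exact ((continuousAt_const.mul (h S.B₁)).eventually_const_lt h0).mono fun _ ↦ Or.inr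
  have e2 : ∀ᶠ z in 𝓝 y, ∀ k : Fin (m + 1),
      evalParam (S.A k.succ) z ≠ 0 ∨ ε * S.p k z < 0 := by
    refine eventually_all.2 fun k ↦ ?_
    rcases hk k with h0 | h0
    · exact ((h _).eventually_ne h0).mono fun _ ↦ Or.inl
    · exact ((continuousAt_const.mul (S.continuousAt_p k (hN.N_ne_zero y hyU))).eventually_lt_const
        h0).mono fun _ ↦ Or.inr
  filter_upwards [e1, e2, hU.mem_nhds hyU] with z h1 h2 h3 h4
  exact mem_F_iff.2 ⟨⟨h3, h4⟩, h1, h2⟩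

/-- Points of `F_ε` where a leading coefficient vanishes have a positive discriminant. -/
theorem disc_pos_of_mem_Winf (hm : m = 0 ∨ m = 1) (hS : S.IsCompatible)
    (hN : S.IsNondegenerate U) {y : Fin t → ℝ} (hyU : y ∈ U) (hW : y ∈ S.Winf) :
    0 < S.disc y := by
  obtain ⟨k, hk⟩ := hW
  cases k using Fin.cases with
  | zero =>
    have hB : evalParam S.B₁ y ≠ 0 := fun hB ↦ hN.A₁_B₁ y hyU ⟨hk, hB⟩
    rw [disc, hk]
    simp only [mul_zero, zero_mul, sub_zero]
    positivity
  | succ k =>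
    obtain ⟨a, b, c, h⟩ := hS.exists_isPartner hm k
    rw [h.disc_eq (hN.N_ne_zero y hyU) hk]
    have : S.p k y ≠ 0 := fun hp ↦ hN.A_p k y hyU ⟨hk, hp⟩
    positivity

/-- Near any point of `U` there are points outside `W_∞` where a given nonzero polynomial does not
vanish. -/
theorem exists_notMem_Winf (hS : S.IsCompatible) {w : MvPolynomial (Fin t) ℚ} (hw : w ≠ 0)
    {V : Set (Fin t → ℝ)} {y : Fin t → ℝ} (hV : V ∈ 𝓝 y) :
    ∃ z ∈ V, z ∉ S.Winf ∧ evalParam w z ≠ 0 := by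
  have hP : (∏ k, S.A k) * w ≠ 0 :=
    mul_ne_zero (Finset.prod_ne_zero_iff.2 fun k _ ↦ hS.leading_ne_zero k) hw
  obtain ⟨z, hz, h⟩ := exists_evalParam_ne_zero hP hV
  have h' : (∏ k, evalParam (S.A k) z) * evalParam w z ≠ 0 := by
    simpa [evalParam, map_prod] using h
  refine ⟨z, hz, ?_, right_ne_zero_of_mul h'⟩
  rintro ⟨k, hk⟩
  exact Finset.prod_ne_zero_iff.1 (left_ne_zero_of_mul h') k (Finset.mem_univ k) hk

/-- At a point of F_ε in W_∞ one has Δ > 0, so a whole neighbourhood lies in F_o, and the nonzero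
polynomial A₁⋯A_n cannot vanish on all of it. This makes limits from F_o \ W_∞ unique. -/
theorem F_subset_closure (hm : m = 0 ∨ m = 1) (hU : IsOpen U) (hS : S.IsCompatible)
    (hN : S.IsNondegenerate U) : S.F U ε ⊆ closure (S.Fo U \ S.Winf) := by
  intro y hy
  obtain ⟨⟨hyU, hd⟩, -⟩ := mem_F_iff.1 hy
  by_cases hW : y ∈ S.Winf
  · have hpos := disc_pos_of_mem_Winf hm hS hN hyU hW
    rw [mem_closure_iff_nhds]
    intro V hV
    have hV' : V ∩ U ∩ {z | 0 < S.disc z} ∈ 𝓝 y :=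
      inter_mem (inter_mem hV (hU.mem_nhds hyU))
        (S.continuous_disc.continuousAt.eventually_const_lt hpos)
    obtain ⟨z, ⟨⟨hzV, hzU⟩, hzd⟩, hzW, -⟩ := exists_notMem_Winf hS one_ne_zero hV'
    exact ⟨z, hzV, ⟨hzU, le_of_lt hzd⟩, hzW⟩
  · exact subset_closure ⟨⟨hyU, hd⟩, hW⟩

/-- This form selects the root without a division, so that it still makes sense where A₁ = 0. -/
theorem branchRoot_spec {y : Fin t → ℝ} (hε : ε = 1 ∨ ε = -1) (hA : evalParam (S.A 0) y ≠ 0) :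
    ε * (2 * evalParam (S.A 0) y * S.branchRoot ε y + evalParam S.B₁ y) = √(S.disc y) := by
  rw [branchRoot]
  rcases hε with rfl | rfl <;> field_simp <;> ring

/-- The condition `ε (2 A₁ x + B₁) = √Δ` characterizes a root of the pivot equation. -/
theorem pivot_of_spec {y : Fin t → ℝ} {x : ℝ} (hε : ε = 1 ∨ ε = -1)
    (hA : evalParam (S.A 0) y ≠ 0) (hd : 0 ≤ S.disc y)
    (h : ε * (2 * evalParam (S.A 0) y * x + evalParam S.B₁ y) = √(S.disc y)) :
    evalParam (S.A 0) y * x ^ 2 + evalParam S.B₁ y * x + evalParam S.C₁ y = 0 := by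
  have h1 := Real.sq_sqrt hd
  have h2 : ε ^ 2 = 1 := by rcases hε with rfl | rfl <;> norm_num
  rw [← h, mul_pow, h2, disc] at h1
  apply (mul_eq_zero_iff_left hA).1
  linear_combination (1 / 4) * h1

/-- Only the product equation is not built into the formula. Multiplied by A₂ (n = 2) or A₂A₃ (n =
3), it becomes ∓N times the pivot equation by compatibility. -/
theorem branchFormula_mem_zeros (hm : m = 0 ∨ m = 1) (hS : S.IsCompatible)
    (hN : S.IsNondegenerate U) (hε : ε = 1 ∨ ε = -1) {y : Fin t → ℝ} (hy : y ∈ S.Fo U \ S.Winf) :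
    (y, S.branchFormula ε y) ∈ S.zeros := by
  obtain ⟨⟨hyU, hd⟩, hW⟩ := hy
  simp only [Winf, mem_ofPred_eq, not_exists] at hW
  have hpiv := pivot_of_spec hε (hW 0) hd (branchRoot_spec hε (hW 0))
  have htail : ∀ k : Fin (m + 1), evalParam (S.A k.succ) y * S.branchFormula ε y k.succ
      + (evalParam (S.u k) y * S.branchRoot ε y + evalParam (S.v k) y) = 0 := by
    intro k
    have := hW k.succ
    simp only [branchFormula, Fin.cons_succ]
    field_simp
    ring
  refine ⟨by simpa [Pivot, branchFormula] using hpiv, htail, ?_⟩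
  generalize hx : S.branchRoot ε y = x at *
  rcases hm with rfl | rfl
  · obtain ⟨h1, h2, h3⟩ := hS.relation_two rfl
    have e1 : evalParam (S.u 0) y = evalParam (S.A 0) y * evalParam S.N y := by
      simpa [evalParam] using congrArg (fun P ↦ evalParam P y) h1
    have e2 : evalParam (S.v 0) y = evalParam S.B₁ y * evalParam S.N y := by
      simpa [evalParam] using congrArg (fun P ↦ evalParam P y) h2
    have e3 : evalParam (S.A 1) y * evalParam S.C₀ y = evalParam S.C₁ y * evalParam S.N y := by
      simpa [evalParam] using congrArg (fun P ↦ evalParam P y) h3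
    have t0 : evalParam (S.A 1) y * S.branchFormula ε y 1
      + (evalParam (S.u 0) y * x + evalParam (S.v 0) y) = 0 := htail 0
    have hb0 : S.branchFormula ε y 0 = x := by simpa [branchFormula] using hx
    change S.branchFormula ε y 1 * S.branchFormula ε y 0 - evalParam S.C₀ y = 0
    rw [hb0]
    apply (mul_eq_zero_iff_left (hW 1)).1
    linear_combination x * t0 - e3 - evalParam S.N y * hpiv - x ^ 2 * e1 - x * e2
  · obtain ⟨h1, h2, h3⟩ := hS.relation_three rfl
    have e1 : evalParam (S.u 0) y * evalParam (S.u 1) y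
        = evalParam (S.A 0) y * evalParam S.N y := by
      simpa [evalParam] using congrArg (fun P ↦ evalParam P y) h1
    have e2 : evalParam (S.v 1) y * evalParam (S.u 0) y + evalParam (S.u 1) y * evalParam (S.v 0) y
        = evalParam S.B₁ y * evalParam S.N y := by
      simpa [evalParam] using congrArg (fun P ↦ evalParam P y) h2
    have e3 : evalParam (S.v 1) y * evalParam (S.v 0) y
        - evalParam (S.A 1) y * evalParam (S.A 2) y * evalParam S.C₀ y
        = evalParam S.C₁ y * evalParam S.N y := by
      simpa [evalParam] using congrArg (fun P ↦ evalParam P y) h3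
    have t0 : evalParam (S.A 1) y * S.branchFormula ε y 1
      + (evalParam (S.u 0) y * x + evalParam (S.v 0) y) = 0 := htail 0
    have t1 : evalParam (S.A 2) y * S.branchFormula ε y 2
      + (evalParam (S.u 1) y * x + evalParam (S.v 1) y) = 0 := htail 1
    change S.branchFormula ε y 2 * S.branchFormula ε y 1 - evalParam S.C₀ y = 0
    apply (mul_eq_zero_iff_left (mul_ne_zero (hW 1) (hW 2))).1
    linear_combination evalParam (S.A 1) y * S.branchFormula ε y 1 * t1
      - (evalParam (S.u 1) y * x + evalParam (S.v 1) y) * t0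
      + evalParam S.N y * hpiv + x ^ 2 * e1 + x * e2 + e3

/-! ### Extension of the branch by continuity, and its uniqueness -/

/-- The first coordinate of the branch has a limit at every point of `F_ε`. -/
theorem exists_tendsto_branchRoot (hε : ε = 1 ∨ ε = -1) {y : Fin t → ℝ} (hy : y ∈ S.F U ε) :
    ∃ x, Tendsto (S.branchRoot ε) (𝓝[S.Fo U \ S.Winf] y) (𝓝 x) ∧
      ε * (2 * evalParam (S.A 0) y * x + evalParam S.B₁ y) = √(S.disc y) := by
  obtain ⟨⟨hyU, hd⟩, h0, -⟩ := mem_F_iff.1 hy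
  have h (P : MvPolynomial (Fin t) ℚ) :
      Tendsto (evalParam P) (𝓝[S.Fo U \ S.Winf] y) (𝓝 (evalParam P y)) :=
    (continuous_evalParam P).continuousWithinAt
  have hs : Tendsto (fun z ↦ √(S.disc z)) (𝓝[S.Fo U \ S.Winf] y) (𝓝 √(S.disc y)) :=
    S.continuous_disc.sqrt.continuousWithinAt
  by_cases hA : evalParam (S.A 0) y = 0
  · have hB : 0 < ε * evalParam S.B₁ y := h0.resolve_left (not_not.2 hA)
    have hsy : √(S.disc y) = ε * evalParam S.B₁ y := by
      rw [Real.sqrt_eq_iff_mul_self_eq hd hB.le, disc, hA]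
      rcases hε with rfl | rfl <;> ring
    -- The root formula rationalized by its conjugate; at A₁ = 0 the denominator is 2B₁.
    refine ⟨-2 * evalParam S.C₁ y / (evalParam S.B₁ y + ε * √(S.disc y)), ?_, ?_⟩
    · have hne : evalParam S.B₁ y + ε * √(S.disc y) ≠ 0 := by
        rw [hsy]
        rcases hε with rfl | rfl <;> intro h0 <;> simp at hB <;> linarith
      have hden := (h S.B₁).add (hs.const_mul ε)
      refine (((h S.C₁).const_mul (-2)).div hden hne).congr' ?_
      filter_upwards [self_mem_nhdsWithin, hden.eventually_ne hne] with z hz hzne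
      have hAz : evalParam (S.A 0) z ≠ 0 := fun h0 ↦ hz.2 ⟨0, h0⟩
      rw [Pi.div_apply, branchRoot, div_eq_div_iff hzne (by simpa using hAz)]
      have h1 := Real.sq_sqrt hz.1.2
      have h2 : ε ^ 2 = 1 := by rcases hε with rfl | rfl <;> norm_num
      have h3 : S.disc z = evalParam S.B₁ z ^ 2 - 4 * evalParam (S.A 0) z * evalParam S.C₁ z := rfl
      linear_combination -ε ^ 2 * h1 - S.disc z * h2 - h3
    · rw [hsy, hA]
      ring
  · refine ⟨S.branchRoot ε y, ?_, branchRoot_spec hε hA⟩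
    exact (((h S.B₁).neg).add (hs.const_mul ε)).div ((h _).const_mul 2) (by simpa using hA)

/-- The branch formula has a limit at every point of `F_ε`. -/
theorem exists_tendsto_branchFormula (hm : m = 0 ∨ m = 1) (hS : S.IsCompatible)
    (hN : S.IsNondegenerate U) (hε : ε = 1 ∨ ε = -1) {y : Fin t → ℝ} (hy : y ∈ S.F U ε) :
    ∃ x, Tendsto (S.branchFormula ε) (𝓝[S.Fo U \ S.Winf] y) (𝓝 x) := by
  obtain ⟨x₁, hx, hspec⟩ := exists_tendsto_branchRoot hε hy
  obtain ⟨⟨hyU, hd⟩, -, hk⟩ := mem_F_iff.1 hy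
  have h (P : MvPolynomial (Fin t) ℚ) :
      Tendsto (evalParam P) (𝓝[S.Fo U \ S.Winf] y) (𝓝 (evalParam P y)) :=
    (continuous_evalParam P).continuousWithinAt
  suffices H : ∀ i, ∃ x, Tendsto (fun z ↦ S.branchFormula ε z i) (𝓝[S.Fo U \ S.Winf] y) (𝓝 x) by
    choose x hx using H
    exact ⟨x, tendsto_pi_nhds.2 hx⟩
  intro i
  cases i using Fin.cases with
  | zero => exact ⟨x₁, by simpa [branchFormula] using hx⟩
  | succ k =>
    by_cases hA : evalParam (S.A k.succ) y = 0
    -- The partner relation rewrites x_k as -aC₀/(bx₁ + c), whose denominator has a nonzero limit.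
    · obtain ⟨a, b, c, hp⟩ := hS.exists_isPartner hm k
      have hne := hp.linear_ne_zero hε (hN.N_ne_zero y hyU) hA
        ((hk k).resolve_left (not_not.2 hA)) hspec
      have hden := ((h b).mul hx).add (h c)
      refine ⟨_, ((((h a).mul (h S.C₀)).neg).div hden hne).congr' ?_⟩
      filter_upwards [self_mem_nhdsWithin, hden.eventually_ne hne] with z hz hzne
      have := hp.tail _ (branchFormula_mem_zeros hm hS hN hε hz).2
      have h0 : S.branchFormula ε z 0 = S.branchRoot ε z := rfl
      simp only [h0] at this
      rw [Pi.div_apply, div_eq_iff hzne]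
      linear_combination -this
    · refine ⟨-(evalParam (S.u k) y * x₁ + evalParam (S.v k) y) / evalParam (S.A k.succ) y, ?_⟩
      simp only [branchFormula, Fin.cons_succ]
      exact ((((h _).mul hx).add (h _)).neg).div (h _) hA

theorem continuousOn_branch (hm : m = 0 ∨ m = 1) (hU : IsOpen U) (hS : S.IsCompatible)
    (hN : S.IsNondegenerate U) (hε : ε = 1 ∨ ε = -1) :
    ContinuousOn (S.branch U ε) (S.F U ε) :=
  continuousOn_extendFrom (F_subset_closure hm hU hS hN)
    fun _ hy ↦ exists_tendsto_branchFormula hm hS hN hε hy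

theorem tendsto_branchFormula (hm : m = 0 ∨ m = 1) (hS : S.IsCompatible)
    (hN : S.IsNondegenerate U) (hε : ε = 1 ∨ ε = -1) {y : Fin t → ℝ} (hy : y ∈ S.F U ε) :
    Tendsto (S.branchFormula ε) (𝓝[S.Fo U \ S.Winf] y) (𝓝 (S.branch U ε y)) :=
  tendsto_extendFrom (exists_tendsto_branchFormula hm hS hN hε hy)

theorem branch_spec (hm : m = 0 ∨ m = 1) (hU : IsOpen U) (hS : S.IsCompatible)
    (hN : S.IsNondegenerate U) (hε : ε = 1 ∨ ε = -1) {y : Fin t → ℝ} (hy : y ∈ S.F U ε) :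
    ε * (2 * evalParam (S.A 0) y * S.branch U ε y 0 + evalParam S.B₁ y) = √(S.disc y) := by
  obtain ⟨x₁, hx, hspec⟩ := exists_tendsto_branchRoot hε hy
  have : (𝓝[S.Fo U \ S.Winf] y).NeBot :=
    mem_closure_iff_nhdsWithin_neBot.1 (F_subset_closure hm hU hS hN hy)
  have h0 := tendsto_pi_nhds.1 (tendsto_branchFormula hm hS hN hε hy) 0
  rw [tendsto_nhds_unique h0 hx]
  exact hspec

theorem isClosed_zeros (S : TriangularSystem t m) : IsClosed S.zeros := by
  have h (P : MvPolynomial (Fin t) ℚ) :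
      Continuous fun z : (Fin t → ℝ) × (Fin (m + 2) → ℝ) ↦ evalParam P z.1 :=
    (continuous_evalParam P).comp continuous_fst
  have hx (i : Fin (m + 2)) : Continuous fun z : (Fin t → ℝ) × (Fin (m + 2) → ℝ) ↦ z.2 i := by
    fun_prop
  simp only [zeros, Pivot, Tail, ofPred_and, ofPred_forall]
  refine IsClosed.inter ?_ (IsClosed.inter (isClosed_iInter fun k ↦ ?_) ?_)
  · exact isClosed_eq ((((h _).mul ((hx 0).pow 2)).add ((h _).mul (hx 0))).add (h _))
      continuous_const
  · exact isClosed_eq (((h _).mul (hx _)).add (((h _).mul (hx 0)).add (h _))) continuous_const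
  · exact isClosed_eq (((hx _).mul (hx _)).sub (h _)) continuous_const

/-- The zero set is closed and contains the graph over F_o \ W_∞, hence also its limits. -/
theorem branch_mem_zeros (hm : m = 0 ∨ m = 1) (hU : IsOpen U) (hS : S.IsCompatible)
    (hN : S.IsNondegenerate U) (hε : ε = 1 ∨ ε = -1) {y : Fin t → ℝ} (hy : y ∈ S.F U ε) :
    (y, S.branch U ε y) ∈ S.zeros := by
  have : (𝓝[S.Fo U \ S.Winf] y).NeBot :=
    mem_closure_iff_nhdsWithin_neBot.1 (F_subset_closure hm hU hS hN hy)
  refine S.isClosed_zeros.mem_of_tendsto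
    ((tendsto_id.mono_left nhdsWithin_le_nhds).prodMk_nhds (tendsto_branchFormula hm hS hN hε hy)) ?_
  filter_upwards [self_mem_nhdsWithin] with z hz
  exact branchFormula_mem_zeros hm hS hN hε hz

/-- Over `F_ε`, a zero of the system with `ε (2 A₁ x₁ + B₁) ≥ 0` lies on the branch. -/
theorem eq_branch (hm : m = 0 ∨ m = 1) (hU : IsOpen U) (hS : S.IsCompatible)
    (hN : S.IsNondegenerate U) (hε : ε = 1 ∨ ε = -1) {z : (Fin t → ℝ) × (Fin (m + 2) → ℝ)}
    (hy : z.1 ∈ S.F U ε) (hz : z ∈ S.zeros)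
    (hnn : 0 ≤ ε * (2 * evalParam (S.A 0) z.1 * z.2 0 + evalParam S.B₁ z.1)) :
    z.2 = S.branch U ε z.1 := by
  obtain ⟨y, x⟩ := z
  simp only at hy hnn ⊢
  have hspec := branch_spec hm hU hS hN hε hy
  have hbz := branch_mem_zeros hm hU hS hN hε hy
  obtain ⟨⟨hyU, hd⟩, h0, hk⟩ := mem_F_iff.1 hy
  generalize S.branch U ε y = ξ at *
  have hpx : evalParam (S.A 0) y * x 0 ^ 2 + evalParam S.B₁ y * x 0 + evalParam S.C₁ y = 0 := hz.1
  have hpξ : evalParam (S.A 0) y * ξ 0 ^ 2 + evalParam S.B₁ y * ξ 0 + evalParam S.C₁ y = 0 := hbz.1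
  have hε0 : ε ≠ 0 := by rcases hε with rfl | rfl <;> norm_num
  have hspecx : ε * (2 * evalParam (S.A 0) y * x 0 + evalParam S.B₁ y) = √(S.disc y) := by
    symm
    rw [Real.sqrt_eq_iff_mul_self_eq hd hnn, disc]
    have h2 : ε ^ 2 = 1 := by rcases hε with rfl | rfl <;> norm_num
    linear_combination -(2 * evalParam (S.A 0) y * x 0 + evalParam S.B₁ y) ^ 2 * h2
      - 4 * evalParam (S.A 0) y * hpx
  -- If A₁ = 0 the pivot equation is linear with B₁ ≠ 0; otherwise √Δ determines x₁.
  have hx0 : x 0 = ξ 0 := by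
    by_cases hA : evalParam (S.A 0) y = 0
    · have hB : evalParam S.B₁ y ≠ 0 := fun hB ↦ hN.A₁_B₁ y hyU ⟨hA, hB⟩
      rw [hA] at hpx hpξ
      apply mul_left_cancel₀ hB
      linear_combination hpx - hpξ
    · have := mul_left_cancel₀ hε0 (hspecx.trans hspec.symm)
      apply mul_left_cancel₀ hA
      linear_combination (1 / 2) * this
  ext i
  cases i using Fin.cases with
  | zero => exact hx0
  | succ k =>
    -- If A_k = 0, the k-th equation no longer involves x_k, but the partner relation still
    -- determines it.
    by_cases hA : evalParam (S.A k.succ) y = 0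
    · obtain ⟨a, b, c, hp⟩ := hS.exists_isPartner hm k
      have hne := hp.linear_ne_zero hε (hN.N_ne_zero y hyU) hA
        ((hk k).resolve_left (not_not.2 hA)) hspec
      have e1 := hp.tail _ hz.2
      have e2 := hp.tail _ hbz.2
      simp only at e1 e2
      rw [hx0] at e1
      apply mul_left_cancel₀ hne
      linear_combination e1 - e2
    · have e1 := hz.2.1 k
      have e2 := hbz.2.1 k
      simp only at e1 e2
      rw [hx0] at e1
      apply mul_left_cancel₀ hA
      linear_combination e1 - e2

end Branch

/-! ### Lifting to E along paths -/

section Lift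

variable {r : ℕ} {f : Fin (m + 2) → MvPolynomial (Fin t ⊕ Fin (m + 2)) ℚ}
  {g : Fin r → MvPolynomial (Fin t ⊕ Fin (m + 2)) ℚ} {σ : Fin r → SignRel}
  {S : TriangularSystem t m} {U : Set (Fin t → ℝ)} {ε : ℝ}

/-- The points of `F_ε` whose lift by the branch lies in `E`. -/
def liftable (S : TriangularSystem t m) (U : Set (Fin t → ℝ)) (ε : ℝ)
    (E : Set ((Fin t → ℝ) × (Fin (m + 2) → ℝ))) : Set (Fin t → ℝ) :=
  {y | y ∈ S.F U ε ∧ (y, S.branch U ε y) ∈ E}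

/-- A zero of a factor Q kills some g_k, which a strict sign condition forbids. -/
theorem liftable_subset_G (hσ : ∀ k, (σ k).IsStrict) :
    S.liftable U ε (solutionSet f g σ) ⊆ S.G U ε (irreducibleFactors g) := by
  rintro y ⟨hy, -, hyg⟩
  refine ⟨hy, ?_⟩
  simp only [mem_iUnion, not_exists]
  rintro Q ⟨-, hQ⟩ ⟨⟨y', x⟩, ⟨⟨-, hQ0⟩, -, hx⟩, rfl⟩
  simp only at hx
  subst hx
  obtain ⟨P, hP⟩ := hQ
  have h : ∏ k, evalPoint (g k) (y', S.branch U ε y') = 0 := by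
    have h1 := congrArg (fun P ↦ evalPoint P (y', S.branch U ε y')) hP
    simp only [evalPoint, map_prod, map_mul] at h1 hQ0 ⊢
    rw [h1, hQ0, zero_mul]
  obtain ⟨k, -, hk⟩ := Finset.prod_eq_zero_iff.1 h
  exact (hσ k).ne_zero (hyg k) hk

/-- Lifting into `E` propagates along paths of `G_ε`. -/
theorem liftable_of_joinedIn (hm : m = 0 ∨ m = 1) (hU : IsOpen U) (hS : S.IsCompatible)
    (hN : S.IsNondegenerate U) (hε : ε = 1 ∨ ε = -1) (hσ : ∀ k, (σ k).IsStrict)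
    (hf : ∀ z : (Fin t → ℝ) × (Fin (m + 2) → ℝ), z.1 ∈ U → (z ∈ realZeros f ↔ z ∈ S.zeros))
    {y z : Fin t → ℝ} (hy : y ∈ S.liftable U ε (solutionSet f g σ))
    (hyz : JoinedIn (S.G U ε (irreducibleFactors g)) y z) :
    z ∈ S.liftable U ε (solutionSet f g σ) := by
  obtain ⟨γ, hγ⟩ := hyz
  have hzF : z ∈ S.F U ε := by simpa using (hγ 1).1
  have hcont : Continuous fun s ↦ (γ s, S.branch U ε (γ s)) :=
    γ.continuous.prodMk ((continuousOn_branch hm hU hS hN hε).comp_continuous γ.continuous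
      fun s ↦ (hγ s).1)
  refine ⟨hzF, (hf _ (mem_F_iff.1 hzF).1.1).2 (branch_mem_zeros hm hU hS hN hε hzF), fun k ↦ ?_⟩
  have hgk : g k ≠ 0 := by
    intro h0
    exact (hσ k).ne_zero (hy.2.2 k) (by simp [evalPoint, h0])
  -- A zero of g_k on the lifted path would be a zero of one of its irreducible factors, whose
  -- projected locus is excluded from G_ε.
  have hne : ∀ s, evalPoint (g k) (γ s, S.branch U ε (γ s)) ≠ 0 := by
    intro s h0
    obtain ⟨Q, hQ, hd, hQ0⟩ := exists_irreducible_dvd_evalPoint_eq_zero hgk h0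
    apply (hγ s).2
    simp only [mem_iUnion]
    exact ⟨Q, ⟨hQ, hd.trans (Finset.dvd_prod_of_mem g (Finset.mem_univ k))⟩, _,
      ⟨⟨branch_mem_zeros hm hU hS hN hε (hγ s).1, hQ0⟩, (hγ s).1, rfl⟩, rfl⟩
  have := (hσ k).holds_of_continuous ((continuous_evalPoint (g k)).comp hcont) hne
    (a := 0) (b := 1) (by simpa using hy.2.2 k)
  simpa using this

/-- The liftable points form a relatively open subset of `F_ε`. -/
theorem eventually_liftable (hm : m = 0 ∨ m = 1) (hU : IsOpen U) (hS : S.IsCompatible)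
    (hN : S.IsNondegenerate U) (hε : ε = 1 ∨ ε = -1) (hσ : ∀ k, (σ k).IsStrict)
    (hf : ∀ z : (Fin t → ℝ) × (Fin (m + 2) → ℝ), z.1 ∈ U → (z ∈ realZeros f ↔ z ∈ S.zeros))
    {y : Fin t → ℝ} (hy : y ∈ S.liftable U ε (solutionSet f g σ)) :
    ∀ᶠ z in 𝓝 y, 0 ≤ S.disc z → z ∈ S.liftable U ε (solutionSet f g σ) := by
  have hlim : Tendsto (fun z ↦ (z, S.branch U ε z)) (𝓝[S.F U ε] y) (𝓝 (y, S.branch U ε y)) :=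
    continuousWithinAt_id.prodMk (continuousOn_branch hm hU hS hN hε y hy.1)
  have hsign : ∀ᶠ z in 𝓝[S.F U ε] y, ∀ k, (σ k).Holds (evalPoint (g k) (z, S.branch U ε z)) :=
    eventually_all.2 fun k ↦ (((continuous_evalPoint (g k)).tendsto _).comp hlim).eventually
      ((hσ k).isOpen_holds.mem_nhds (hy.2.2 k))
  filter_upwards [eventually_nhdsWithin_iff.1 hsign, eventually_mem_F hU hN hy.1] with z h1 h2 h3
  have hzF := h2 h3
  exact ⟨hzF, (hf _ (mem_F_iff.1 hzF).1.1).2 (branch_mem_zeros hm hU hS hN hε hzF), h1 hzF⟩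

/-- Where the discriminant vanishes, every point of `E` is on the branch. -/
theorem liftable_of_disc_eq_zero (hm : m = 0 ∨ m = 1) (hU : IsOpen U) (hS : S.IsCompatible)
    (hN : S.IsNondegenerate U) (hε : ε = 1 ∨ ε = -1)
    (hEU : ∀ z ∈ solutionSet f g σ, z.1 ∈ U)
    (hf : ∀ z : (Fin t → ℝ) × (Fin (m + 2) → ℝ), z.1 ∈ U → (z ∈ realZeros f ↔ z ∈ S.zeros))
    {z : (Fin t → ℝ) × (Fin (m + 2) → ℝ)} (hz : z ∈ solutionSet f g σ) (hd : S.disc z.1 = 0) :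
    z.1 ∈ S.liftable U ε (solutionSet f g σ) := by
  have hzU := hEU z hz
  have hzz : z ∈ S.zeros := (hf z hzU).1 hz.1
  have hzF : z.1 ∈ S.F U ε := Fo_diff_Winf_subset_F
    ⟨⟨hzU, hd.ge⟩, fun hW ↦ (disc_pos_of_mem_Winf hm hS hN hzU hW).ne' hd⟩
  have hpiv : evalParam (S.A 0) z.1 * z.2 0 ^ 2 + evalParam S.B₁ z.1 * z.2 0
    + evalParam S.C₁ z.1 = 0 := hzz.1
  -- This square equals Δ at a root, so the sign condition of the branch holds for both values of ε.
  have hsq : (2 * evalParam (S.A 0) z.1 * z.2 0 + evalParam S.B₁ z.1) ^ 2 = 0 := by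
    rw [disc] at hd
    linear_combination 4 * evalParam (S.A 0) z.1 * hpiv + hd
  refine ⟨hzF, ?_⟩
  rw [← eq_branch hm hU hS hN hε hzF hzz (by rw [pow_eq_zero_iff two_ne_zero |>.1 hsq, mul_zero])]
  exact hz

theorem disc_nonneg_of_mem_zeros {z : (Fin t → ℝ) × (Fin (m + 2) → ℝ)} (hz : z ∈ S.zeros) :
    0 ≤ S.disc z.1 := by
  have hpiv : evalParam (S.A 0) z.1 * z.2 0 ^ 2 + evalParam S.B₁ z.1 * z.2 0
    + evalParam S.C₁ z.1 = 0 := hz.1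
  have : S.disc z.1 = (2 * evalParam (S.A 0) z.1 * z.2 0 + evalParam S.B₁ z.1) ^ 2 := by
    rw [disc]
    linear_combination -4 * evalParam (S.A 0) z.1 * hpiv
  rw [this]
  positivity

/-- Every path-connected component of the liftable set contains a point with positive
discriminant. -/
theorem exists_joinedIn_disc_pos (hm : m = 0 ∨ m = 1) (hU : IsOpen U) (hS : S.IsCompatible)
    (hN : S.IsNondegenerate U) (hε : ε = 1 ∨ ε = -1) (hσ : ∀ k, (σ k).IsStrict)
    (hEU : ∀ z ∈ solutionSet f g σ, z.1 ∈ U)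
    (hf : ∀ z : (Fin t → ℝ) × (Fin (m + 2) → ℝ), z.1 ∈ U → (z ∈ realZeros f ↔ z ∈ S.zeros))
    (hE : ∀ C ∈ pathComponentsOf (solutionSet f g σ), ∃ z ∈ C, S.disc z.1 ≠ 0)
    {y : Fin t → ℝ} (hy : y ∈ S.liftable U ε (solutionSet f g σ)) :
    ∃ z, JoinedIn (S.liftable U ε (solutionSet f g σ)) y z ∧ 0 < S.disc z := by
  obtain ⟨z, ⟨γ, hγ⟩, hz⟩ := hE _ ⟨_, hy.2, rfl⟩
  have hnn : ∀ s, 0 ≤ S.disc (γ s).1 := fun s ↦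
    disc_nonneg_of_mem_zeros ((hf _ (hEU _ (hγ s))).1 (hγ s).1)
  by_contra! hle
  set H := S.liftable U ε (solutionSet f g σ) with hH
  set δ : ℝ → (Fin t → ℝ) := fun s ↦ (γ.extend s).1 with hδ
  have hδc : Continuous δ := continuous_fst.comp γ.continuous_extend
  have hδnn : ∀ s, 0 ≤ S.disc (δ s) := fun s ↦ hnn _
  have hδH : ∀ s, S.disc (δ s) = 0 → δ s ∈ H := fun s hs ↦
    liftable_of_disc_eq_zero hm hU hS hN hε hEU hf (hγ _) hs
  have hδ0 : δ 0 = y := by simp [hδ]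
  have hδ1 : δ 1 = z.1 := by simp [hδ]
  -- Continuous induction along the projected path. If Δ = 0 on [0, s], relative openness keeps the
  -- path in H slightly beyond s. Those points are joined to y in H, so Δ ≤ 0 there by the
  -- contradiction hypothesis, while Δ ≥ 0 on the projection of E.
  have hmain : Icc (0 : ℝ) 1 ⊆ {s | S.disc (δ s) = 0} := by
    refine IsClosed.Icc_subset_of_forall_mem_nhdsGT_of_Icc_subset ?_ ?_ fun s hs hsub ↦ ?_
    · exact (isClosed_eq (S.continuous_disc.comp hδc) continuous_const).inter isClosed_Icc
    · rw [mem_ofPred_eq, hδ0]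
      exact le_antisymm (hle y (JoinedIn.refl hy)) (hδ0 ▸ hδnn 0)
    · have hev : ∀ᶠ u in 𝓝 s, δ u ∈ H := by
        have hsH : δ s ∈ H := hδH s (hsub ⟨hs.1, le_rfl⟩)
        filter_upwards [hδc.continuousAt.eventually
          (eventually_liftable hm hU hS hN hε hσ hf hsH)] with u hu using hu (hδnn u)
      obtain ⟨e, he, hball⟩ := Metric.mem_nhds_iff.1 hev
      filter_upwards [Ioo_mem_nhdsGT (show s < s + e by linarith)] with u hu
      have hsubH : δ '' Icc 0 u ⊆ H := by
        rintro _ ⟨v, hv, rfl⟩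
        rcases le_or_gt v s with hvs | hvs
        · exact hδH v (hsub ⟨hv.1, hvs⟩)
        · apply hball
          rw [Real.ball_eq_Ioo]
          exact ⟨by linarith, by linarith [hv.2, hu.2]⟩
      have hu0 : 0 ≤ u := hs.1.trans hu.1.le
      have hconn := ((convex_Icc 0 u).isPathConnected ⟨0, left_mem_Icc.2 hu0⟩).image hδc
      have hj := (hconn.joinedIn (δ 0) ⟨0, left_mem_Icc.2 hu0, rfl⟩ (δ u)
        ⟨u, right_mem_Icc.2 hu0, rfl⟩).mono hsubH
      rw [hδ0] at hj
      exact le_antisymm (hle _ hj) (hδnn u)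
  apply hz
  rw [← hδ1]
  exact hmain (right_mem_Icc.2 zero_le_one)

/-- A liftable point is joined to a sample point inside `G_ε`. -/
theorem exists_joinedIn_sample (hm : m = 0 ∨ m = 1) (hU : IsOpen U) (hS : S.IsCompatible)
    (hN : S.IsNondegenerate U) (hε : ε = 1 ∨ ε = -1) (hσ : ∀ k, (σ k).IsStrict)
    (hf : ∀ z : (Fin t → ℝ) × (Fin (m + 2) → ℝ), z.1 ∈ U → (z ∈ realZeros f ↔ z ∈ S.zeros))
    {w : MvPolynomial (Fin t) ℚ} (hw : w ≠ 0)
    (hwQ : ∀ Q ∈ irreducibleFactors g, ∀ z ∈ S.locus Q, z.1 ∈ U → evalParam w z.1 = 0)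
    {L : Set (Fin t → ℝ)} (hL : IsExhaustiveSample L (S.sampledSet U w))
    {y : Fin t → ℝ} (hy : y ∈ S.liftable U ε (solutionSet f g σ)) (hd : 0 < S.disc y) :
    ∃ η ∈ L, JoinedIn (S.G U ε (irreducibleFactors g)) y η := by
  have hev : ∀ᶠ z in 𝓝 y, 0 < S.disc z ∧ z ∈ S.liftable U ε (solutionSet f g σ) := by
    filter_upwards [S.continuous_disc.continuousAt.eventually_const_lt hd,
      eventually_liftable hm hU hS hN hε hσ hf hy] with z h1 h2 using ⟨h1, h2 h1.le⟩
  obtain ⟨δ, hδ, hball⟩ := Metric.mem_nhds_iff.1 hev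
  obtain ⟨y₁, hy₁, hW, hw₁⟩ := exists_notMem_Winf hS hw (Metric.ball_mem_nhds y hδ)
  have h1 : JoinedIn (S.G U ε (irreducibleFactors g)) y y₁ :=
    (((convex_ball y δ).isPathConnected ⟨y, Metric.mem_ball_self hδ⟩).joinedIn y
      (Metric.mem_ball_self hδ) y₁ hy₁).mono fun z hz ↦ liftable_subset_G hσ (hball hz).2
  have hy₁s : y₁ ∈ S.sampledSet U w :=
    ⟨(mem_F_iff.1 (hball hy₁).2.1).1.1, (hball hy₁).1, hW, hw₁⟩
  obtain ⟨η, hη, hηL⟩ := hL.2 _ ⟨y₁, hy₁s, rfl⟩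
  refine ⟨η, hηL, h1.trans (JoinedIn.mono hη ?_)⟩
  -- The sampled set lies in G_ε because w vanishes on every projected locus.
  rintro z ⟨hzU, hzd, hzW, hzw⟩
  refine ⟨Fo_diff_Winf_subset_F ⟨⟨hzU, hzd.le⟩, hzW⟩, ?_⟩
  simp only [mem_iUnion, not_exists]
  rintro Q hQ ⟨p, ⟨hp, -⟩, rfl⟩
  exact hzw (hwQ Q hQ p hp hzU)

end Lift

end TriangularSystem

end

/-! ### The homeomorphism -/

theorem mainTheorem3 (t m r : ℕ) (hm : m = 0 ∨ m = 1)
    (f : Fin (m + 2) → MvPolynomial (Fin t ⊕ Fin (m + 2)) ℚ)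
    (g : Fin r → MvPolynomial (Fin t ⊕ Fin (m + 2)) ℚ)
    (σ : Fin r → SignRel) (hσ : ∀ k, (σ k).IsStrict)
    (S : TriangularSystem t m) (U : Set (Fin t → ℝ)) (hU : IsOpen U)
    (hEU : ∀ z ∈ solutionSet f g σ, z.1 ∈ U)
    (hf : ∀ z : (Fin t → ℝ) × (Fin (m + 2) → ℝ), z.1 ∈ U →
      (z ∈ realZeros f ↔ z ∈ S.zeros))
    (hS : S.IsCompatible)
    (hN : S.IsNondegenerate U)
    (hQ : ∀ Q ∈ irreducibleFactors g, S.HasNormalForm U Q)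
    (hE : ∀ C ∈ pathComponentsOf (solutionSet f g σ), ∃ z ∈ C, S.disc z.1 ≠ 0)
    (w : MvPolynomial (Fin t) ℚ) (hw : w ≠ 0)
    (hwQ : ∀ Q ∈ irreducibleFactors g, ∀ z ∈ S.locus Q, z.1 ∈ U → evalParam w z.1 = 0)
    (L : Set (Fin t → ℝ)) (hL : IsExhaustiveSample L (S.sampledSet U w))
    (ε : ℝ) (hε : ε = 1 ∨ ε = -1) :
    Nonempty (S.branchPiece U (solutionSet f g σ) ε ≃ₜ
      S.Go U ε (irreducibleFactors g) (solutionSet f g σ) L) := by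
  have hGo : S.Go U ε (irreducibleFactors g) (solutionSet f g σ) L
      = S.liftable U ε (solutionSet f g σ) := by
    apply Subset.antisymm
    · rintro y ⟨C, ⟨⟨x, -, rfl⟩, η, hη, -, hηE⟩, hy⟩
      have hηy : JoinedIn (S.G U ε (irreducibleFactors g)) η y :=
        (JoinedIn.symm hη).trans hy
      exact TriangularSystem.liftable_of_joinedIn hm hU hS hN hε hσ hf
        ⟨hηy.source_mem.1, hηE⟩ hηy
    · intro y hy
      obtain ⟨z, hyz, hd⟩ :=
        TriangularSystem.exists_joinedIn_disc_pos hm hU hS hN hε hσ hEU hf hE hy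
      obtain ⟨η, hηL, hzη⟩ := TriangularSystem.exists_joinedIn_sample hm hU hS hN hε hσ hf hw hwQ hL
        hyz.target_mem hd
      have hyη := (hyz.mono (TriangularSystem.liftable_subset_G hσ)).trans hzη
      have hyG := TriangularSystem.liftable_subset_G hσ hy
      exact ⟨_, ⟨⟨y, hyG, rfl⟩, η, hyη, hηL,
        (TriangularSystem.liftable_of_joinedIn hm hU hS hN hε hσ hf hy hyη).2⟩, JoinedIn.refl hyG⟩
  rw [hGo]
  have hgraph : ∀ z ∈ S.branchPiece U (solutionSet f g σ) ε, z.2 = S.branch U ε z.1 :=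
    fun z hz ↦ TriangularSystem.eq_branch hm hU hS hN hε hz.2.1 ((hf z (hEU z hz.1)).1 hz.1.1) hz.2.2
  refine ⟨{
    toFun := fun z ↦ ⟨z.1.1, z.2.2.1, ?_⟩
    invFun := fun y ↦ ⟨(y.1, S.branch U ε y.1), y.2.2, y.2.1, ?_⟩
    left_inv := fun z ↦ Subtype.ext (Prod.ext rfl (hgraph z.1 z.2).symm)
    right_inv := fun y ↦ rfl
    continuous_toFun := by fun_prop
    continuous_invFun := ?_ }⟩
  · rw [← hgraph z.1 z.2]
    exact z.2.1
  -- On the branch, the quantity in the sign condition is √Δ.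
  · rw [TriangularSystem.branch_spec hm hU hS hN hε y.2.1]
    exact Real.sqrt_nonneg _
  · exact (continuous_subtype_val.prodMk
      ((TriangularSystem.continuousOn_branch hm hU hS hN hε).comp_continuous
        continuous_subtype_val fun y ↦ y.2.1)).subtype_mk _
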